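/- Consider the packing of the plane by circles of radius $2$ with centers $(4i+2j+2,\,2\sqrt3\,j)$, $i,j\in\mathbb Z$, so that the origin is the tangency point of two horizontally aligned circles. On each circle consider the six arcs, each traversed from its left end to its right end, that run between the angles $180^\circ\to120^\circ$ ($U$), $120^\circ\to60^\circ$ ($F$), $60^\circ\to0^\circ$ ($D$), $300^\circ\to360^\circ$ ($\overline U$), $240^\circ\to300^\circ$ ($\overline F$), $180^\circ\to240^\circ$ ($\overline D$). A packing path is a finite (possibly empty) concatenation of such arcs of circles of the packing that starts at the origin, stays in the quarter plane $\{x\ge 0,\ y\ge 0\}$, and ends on the $x$-axis; its number of steps is its number of arcs. Let $a_n$ be the number of packing paths with $n$ steps and let $S(x)=\sum_{n\ge0}a_nx^n$. Then: 1. As formal power series, $$S(x)=\frac{1-x-\sqrt{(1-x)(1-2x)(1+x+2x^2)}}{2x^3},$$ where the square root is the one with constant term $1$. 2. $a_0=1$, and for every $n\ge 0$ $$a_n=\sum_{k=0}^{\lfloor n/3\rfloor}\frac1{k+1}\binom{2k}{k}\binom{n-2k-1}{n-3k},$$ with the usual convention $\binom{-1}{0}=1$ (needed only for $n=0$). 3.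 As $n\to\infty$, $$a_n\sim\frac{2^{n+1}}{\sqrt{\pi}\,n^{3/2}}.$$ -/

import Mathlib

namespace HexPacking

/-- The centers of the circles of the hexagonal circle packing by circles of radius `2`,
placed so that the origin is the tangency point of two horizontally aligned circles
(those with centers `(-2, 0)` and `(2, 0)`). -/
def centers : Set (ℝ × ℝ) :=
  {c | ∃ i j : ℤ, c = (4 * (i : ℝ) + 2 * (j : ℝ) + 2, 2 * Real.sqrt 3 * (j : ℝ))}

/-- The point at angle `θ` on the circle of radius `2` with center `c`. -/
noncomputable def circlePoint (c : ℝ × ℝ) (θ : ℝ) : ℝ × ℝ :=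
  (c.1 + 2 * Real.cos θ, c.2 + 2 * Real.sin θ)

/-- The six types of arcs: `U = NE`, `F = E`, `D = SE` and their barred versions. -/
inductive Step
  | U
  | F
  | D
  | Ubar
  | Fbar
  | Dbar
  deriving DecidableEq

/-- The angle, on its circle, of the starting point of an arc of the given type. -/
noncomputable def Step.startAngle : Step → ℝ
  | .U => Real.pi
  | .F => 2 * Real.pi / 3
  | .D => Real.pi / 3
  | .Ubar => 5 * Real.pi / 3
  | .Fbar => 4 * Real.pi / 3
  | .Dbar => Real.pi

/-- The angle, on its circle, of the endpoint of an arc of the given type. -/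
noncomputable def Step.endAngle : Step → ℝ
  | .U => 2 * Real.pi / 3
  | .F => Real.pi / 3
  | .D => 0
  | .Ubar => 2 * Real.pi
  | .Fbar => 5 * Real.pi / 3
  | .Dbar => 4 * Real.pi / 3

/-- The arc of type `s` on the circle of radius `2` with center `c`. -/
def Step.arc (s : Step) (c : ℝ × ℝ) : Set (ℝ × ℝ) :=
  circlePoint c '' Set.uIcc s.startAngle s.endAngle

/-- The closed quarter plane. -/
def quarterPlane : Set (ℝ × ℝ) := {p | 0 ≤ p.1 ∧ 0 ≤ p.2}

/-- `IsPath p P q`: the word `P` describes a path from `p` to `q` formed by concatenating arcs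
of circles of the packing, all of them contained in the quarter plane. (A point and the type of
an arc starting there determine the circle, so that a path is determined by its starting point
and its word.) -/
def IsPath : ℝ × ℝ → List Step → ℝ × ℝ → Prop
  | p, [], q => p = q
  | p, s :: P, q => ∃ c ∈ centers, circlePoint c s.startAngle = p ∧ s.arc c ⊆ quarterPlane ∧
      IsPath (circlePoint c s.endAngle) P q

/-- The packing paths: paths starting at the origin and ending on the `x`-axis. -/
def packingPaths : Set (List Step) :=
  {P | ∃ q : ℝ × ℝ, IsPath (0, 0) P q ∧ q.2 = 0}

/-- The number of packing paths with `n` steps. -/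
noncomputable def numPackingPaths (n : ℕ) : ℕ :=
  {P ∈ packingPaths | P.length = n}.ncard

/-- The generating function of packing paths with respect to the number of steps. -/
noncomputable def packingSeries : PowerSeries ℚ :=
  PowerSeries.mk fun n => (numPackingPaths n : ℚ)

end HexPacking

/-!
Every tangency point of the packing has the form `(m, √3 h)` with integers `m` and `h`, and it
belongs to one of three classes, read off from the parity of `h` and from `m - h` modulo `4`. The
class determines the two arcs that start at the point. An arc of the packing starting in the quarter
plane stays there if and only if its endpoint has nonnegative height
(`arc_subset_quarterPlane_iff`), so that packing paths are the words of a counter automaton with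
three states (`exists_isPath_iff_accepts`).

Let `S` be the series with `S = 1 + x³ / (1 - x) S²`, that is, the Catalan generating function at
`x³ / (1 - x)` (`pathSeries`); expanding it gives the sum over `k`. The first-step recurrences for
the numbers of accepted words determine these numbers, and they are solved by `S r ^ k`, `α S r ^ k`
and `β S r ^ k` in the three states on level `k`, where `α = x² S / (1 - x)`, `β = x (1 + α)` and
`r = x β S`: `r` accounts for the descent by one level. Hence `S` is the generating function of
packing paths (`packingSeries_eq`), and completing the square in its quadratic equation shows that
`1 - x - 2x³S` is the root of the discriminant (`discriminantRoot_sq`).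

For the asymptotics, the discriminant root is written over `ℂ` as the product of `√(1 - 2x)` and
`g = √(1 - x) √(1 - ωx) √(1 - ω'x)`, where `|ω| = |ω'| = √2 < 2` (`map_discriminantRoot`). The
coefficients of `√(1 - x)` are Catalan numbers up to elementary factors, so Stirling's formula gives
their asymptotics and each of them is at most `1` in absolute value. The coefficients of `g` are
therefore `O(n² √2 ^ n)`, and dominated convergence (`tendsto_weight_mul_convolution`) shows that
multiplying by `g` multiplies the leading asymptotics by the number `g(1/2)`. Its square is `1`, and
its sign is positive because the coefficients of `S` are nonnegative.
-/

namespace HexPacking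

/-! ### Geometry of the arcs -/

/-- The point with integer coordinates `(m, h)` in units of `1` horizontally and `√3` vertically.
All the centers and all the tangency points of the packing are of this form. -/
noncomputable def latticePoint (m h : ℤ) : ℝ × ℝ := (m, Real.sqrt 3 * h)

/-- The horizontal displacement along an arc. -/
def Step.width : Step → ℤ
  | .U | .D | .Ubar | .Dbar => 1
  | .F | .Fbar => 2

/-- The vertical displacement along an arc, in units of `√3`. -/
def Step.rise : Step → ℤ
  | .U | .Ubar => 1
  | .F | .Fbar => 0
  | .D | .Dbar => -1

/-- The position, in `latticePoint` coordinates, of the center of the circle carrying an arc,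
relative to the starting point of the arc. -/
def Step.centerShift : Step → ℤ × ℤ
  | .U | .Dbar => (2, 0)
  | .F => (1, -1)
  | .D => (-1, -1)
  | .Ubar => (-1, 1)
  | .Fbar => (1, 1)

theorem sqrt_three_pos : 0 < Real.sqrt 3 := by positivity

theorem latticePoint_injective {m h m' h' : ℤ} (e : latticePoint m h = latticePoint m' h') :
    m = m' ∧ h = h' := by
  have h1 := congrArg Prod.fst e
  have h2 := congrArg Prod.snd e
  simp only [latticePoint] at h1 h2
  exact ⟨by exact_mod_cast h1, by exact_mod_cast mul_left_cancel₀ sqrt_three_pos.ne' h2⟩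

theorem latticePoint_mem_centers {M K : ℤ} :
    latticePoint M K ∈ centers ↔ 2 ∣ K ∧ 4 ∣ M - K - 2 := by
  constructor
  · rintro ⟨i, j, e⟩
    have e' : latticePoint M K = latticePoint (4 * i + 2 * j + 2) (2 * j) := by
      rw [e, latticePoint]; push_cast; ext <;> simp; ring
    obtain ⟨h1, h2⟩ := latticePoint_injective e'
    omega
  · rintro ⟨⟨j, hj⟩, ⟨i, hi⟩⟩
    refine ⟨i, j, ?_⟩
    obtain rfl : M = 4 * i + 2 * j + 2 := by omega
    subst hj
    rw [latticePoint]; push_cast; ext <;> simp; ring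

theorem cos_two_pi_div_three : Real.cos (2 * Real.pi / 3) = -(1 / 2) := by
  rw [show 2 * Real.pi / 3 = Real.pi - Real.pi / 3 by ring, Real.cos_pi_sub, Real.cos_pi_div_three]

theorem sin_two_pi_div_three : Real.sin (2 * Real.pi / 3) = Real.sqrt 3 / 2 := by
  rw [show 2 * Real.pi / 3 = Real.pi - Real.pi / 3 by ring, Real.sin_pi_sub, Real.sin_pi_div_three]

theorem cos_four_pi_div_three : Real.cos (4 * Real.pi / 3) = -(1 / 2) := by
  rw [show 4 * Real.pi / 3 = Real.pi / 3 + Real.pi by ring, Real.cos_add_pi, Real.cos_pi_div_three]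

theorem sin_four_pi_div_three : Real.sin (4 * Real.pi / 3) = -(Real.sqrt 3 / 2) := by
  rw [show 4 * Real.pi / 3 = Real.pi / 3 + Real.pi by ring, Real.sin_add_pi, Real.sin_pi_div_three]

theorem cos_five_pi_div_three : Real.cos (5 * Real.pi / 3) = 1 / 2 := by
  rw [show 5 * Real.pi / 3 = 2 * Real.pi - Real.pi / 3 by ring, Real.cos_two_pi_sub,
    Real.cos_pi_div_three]

theorem sin_five_pi_div_three : Real.sin (5 * Real.pi / 3) = -(Real.sqrt 3 / 2) := by
  rw [show 5 * Real.pi / 3 = 2 * Real.pi - Real.pi / 3 by ring, Real.sin_two_pi_sub,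
    Real.sin_pi_div_three]

theorem circlePoint_startAngle (s : Step) (m h : ℤ) :
    circlePoint (latticePoint (m + s.centerShift.1) (h + s.centerShift.2)) s.startAngle =
      latticePoint m h := by
  cases s <;> ext <;>
    simp [circlePoint, latticePoint, Step.startAngle, Step.centerShift, cos_two_pi_div_three,
      sin_two_pi_div_three, cos_four_pi_div_three, sin_four_pi_div_three, cos_five_pi_div_three,
      sin_five_pi_div_three] <;> ring

theorem circlePoint_endAngle (s : Step) (m h : ℤ) :
    circlePoint (latticePoint (m + s.centerShift.1) (h + s.centerShift.2)) s.endAngle =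
      latticePoint (m + s.width) (h + s.rise) := by
  cases s <;> ext <;>
    simp [circlePoint, latticePoint, Step.endAngle, Step.centerShift, cos_two_pi_div_three,
      sin_two_pi_div_three, cos_four_pi_div_three, sin_four_pi_div_three, cos_five_pi_div_three,
      sin_five_pi_div_three, Step.width, Step.rise] <;> ring

/-- Along every arc, the horizontal coordinate is smallest at the starting point. -/
theorem cos_startAngle_le {s : Step} {θ : ℝ} (hθ : θ ∈ Set.uIcc s.startAngle s.endAngle) :
    Real.cos s.startAngle ≤ Real.cos θ := by
  have hpi := Real.pi_pos
  rw [Set.mem_uIcc] at hθ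
  cases s <;> simp only [Step.startAngle, Step.endAngle] at hθ ⊢
  case U | F | D =>
    apply Real.cos_le_cos_of_nonneg_of_le_pi <;> rcases hθ with hθ | hθ <;> linarith [hθ.1, hθ.2]
  case Ubar | Fbar | Dbar =>
    rw [← Real.cos_two_pi_sub, ← Real.cos_two_pi_sub θ]
    apply Real.cos_le_cos_of_nonneg_of_le_pi <;> rcases hθ with hθ | hθ <;> linarith [hθ.1, hθ.2]

theorem sin_nonneg_of_mem_uIcc {s : Step} (hs : s = .U ∨ s = .F ∨ s = .D) {θ : ℝ}
    (hθ : θ ∈ Set.uIcc s.startAngle s.endAngle) : 0 ≤ Real.sin θ := by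
  have hpi := Real.pi_pos
  rw [Set.mem_uIcc] at hθ
  apply Real.sin_nonneg_of_nonneg_of_le_pi <;> rcases hs with rfl | rfl | rfl <;>
    simp only [Step.startAngle, Step.endAngle] at hθ <;> rcases hθ with hθ | hθ <;>
    linarith [hθ.1, hθ.2]

theorem neg_sqrt_three_div_two_le_sin {s : Step} (hs : s = .Ubar ∨ s = .Dbar) {θ : ℝ}
    (hθ : θ ∈ Set.uIcc s.startAngle s.endAngle) : -(Real.sqrt 3 / 2) ≤ Real.sin θ := by
  have hpi := Real.pi_pos
  rw [Set.mem_uIcc] at hθ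
  rcases hs with rfl | rfl <;> simp only [Step.startAngle, Step.endAngle] at hθ
  · have : Real.sin (2 * Real.pi - θ) ≤ Real.sin (Real.pi / 3) := by
      apply Real.sin_le_sin_of_le_of_le_pi_div_two <;> rcases hθ with hθ | hθ <;>
        linarith [hθ.1, hθ.2]
    rw [Real.sin_two_pi_sub, Real.sin_pi_div_three] at this
    linarith
  · have : Real.sin (θ - Real.pi) ≤ Real.sin (Real.pi / 3) := by
      apply Real.sin_le_sin_of_le_of_le_pi_div_two <;> rcases hθ with hθ | hθ <;>
        linarith [hθ.1, hθ.2]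
    rw [Real.sin_sub_pi, Real.sin_pi_div_three] at this
    linarith

/-- For an arc of the packing that starts in the quarter plane, only the height of its endpoint
decides whether it stays there: the arcs `F` and `Fbar` lie at height at least `2√3 - 2 > 0`, and
the height is monotone along the other four. -/
theorem arc_subset_quarterPlane_iff {s : Step} {m h : ℤ} (hm : 0 ≤ m) (hh : 0 ≤ h)
    (hc : latticePoint (m + s.centerShift.1) (h + s.centerShift.2) ∈ centers) :
    s.arc (latticePoint (m + s.centerShift.1) (h + s.centerShift.2)) ⊆ quarterPlane ↔
      0 ≤ h + s.rise := by
  have h3 := sqrt_three_pos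
  constructor
  · intro hs
    have := (hs ⟨s.endAngle, Set.right_mem_uIcc, rfl⟩).2
    rw [circlePoint_endAngle, latticePoint] at this
    exact_mod_cast nonneg_of_mul_nonneg_right this h3
  · rintro hr _ ⟨θ, hθ, rfl⟩
    constructor
    · have h1 := congrArg Prod.fst (circlePoint_startAngle s m h)
      have h2 := cos_startAngle_le hθ
      have h4 : (0 : ℝ) ≤ m := by exact_mod_cast hm
      simp only [circlePoint, latticePoint] at h1 ⊢
      linarith
    · rw [latticePoint_mem_centers] at hc
      have key : ∀ b : ℝ, -b ≤ Real.sin θ →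
          b ≤ Real.sqrt 3 / 2 * (h + s.centerShift.2 : ℤ) →
          0 ≤ (circlePoint (latticePoint (m + s.centerShift.1) (h + s.centerShift.2)) θ).2 := by
        intro b hb1 hb2
        simp only [circlePoint, latticePoint]
        linarith
      have mono : ∀ z : ℤ, z ≤ h + s.centerShift.2 →
          Real.sqrt 3 / 2 * z ≤ Real.sqrt 3 / 2 * (h + s.centerShift.2 : ℤ) := fun z hz =>
        mul_le_mul_of_nonneg_left (by exact_mod_cast hz) (by positivity)
      cases s
      case U | F | D =>
        refine key 0 ?_ ?_
        · rw [neg_zero]; exact sin_nonneg_of_mem_uIcc (by simp) hθ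
        · refine le_trans (by simp) (mono 0 ?_)
          simp only [Step.centerShift, Step.rise] at *; omega
      case Ubar | Dbar =>
        refine key _ (neg_sqrt_three_div_two_le_sin (by simp) hθ) ?_
        refine le_trans (by simp) (mono 1 ?_)
        simp only [Step.centerShift, Step.rise] at *; omega
      case Fbar =>
        refine key 1 (Real.neg_one_le_sin θ) ?_
        refine le_trans ?_ (mono 2 ?_)
        · have : (1 : ℝ) ≤ Real.sqrt 3 := Real.one_le_sqrt.mpr (by norm_num)
          push_cast; linarith
        · simp only [Step.centerShift, Step.rise] at *; omega

theorem isPath_cons_iff {s : Step} {P : List Step} {m h : ℤ} {q : ℝ × ℝ}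
    (hm : 0 ≤ m) (hh : 0 ≤ h) :
    IsPath (latticePoint m h) (s :: P) q ↔
      (2 ∣ h + s.centerShift.2 ∧ 4 ∣ m + s.centerShift.1 - (h + s.centerShift.2) - 2) ∧
      0 ≤ h + s.rise ∧ IsPath (latticePoint (m + s.width) (h + s.rise)) P q := by
  rw [IsPath, ← latticePoint_mem_centers]
  constructor
  · rintro ⟨c, hc, hp, harc, hP⟩
    obtain rfl : c = latticePoint (m + s.centerShift.1) (h + s.centerShift.2) := by
      have h0 := circlePoint_startAngle s m h
      rw [← hp] at h0
      have h1 := congrArg Prod.fst h0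
      have h2 := congrArg Prod.snd h0
      simp only [circlePoint, add_left_inj] at h1 h2
      exact Prod.ext h1.symm h2.symm
    rw [circlePoint_endAngle] at hP
    exact ⟨hc, (arc_subset_quarterPlane_iff hm hh hc).1 harc, hP⟩
  · rintro ⟨hc, hr, hP⟩
    exact ⟨_, hc, circlePoint_startAngle s m h, (arc_subset_quarterPlane_iff hm hh hc).2 hr,
      by rwa [circlePoint_endAngle]⟩

/-! ### Packing paths as words of a counter automaton -/

/-- The three classes of tangency points, by the arcs that start there: `U` and `Dbar` at an
`equator` point, where two horizontally aligned circles touch; `F` and `Ubar` at an `upperLeft`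
point, the upper left tangency point of the circle below it; `D` and `Fbar` at an `upperRight`
point, the upper right tangency point of the circle below it. -/
inductive Site
  | equator
  | upperLeft
  | upperRight

/-- `s.IsAt k m h`: the lattice point `(m, h)` is a tangency point of class `s` at level `k`,
where the equator points at height `2k√3` and the other points at height `(2k+1)√3` make up
level `k`. -/
def Site.IsAt : Site → ℕ → ℤ → ℤ → Prop
  | .equator, k, m, h => h = 2 * k ∧ 4 ∣ m - h
  | .upperLeft, k, m, h => h = 2 * k + 1 ∧ 4 ∣ m - h
  | .upperRight, k, m, h => h = 2 * k + 1 ∧ 4 ∣ m - h - 2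

/-- The words of the paths in the quarter plane from a site of a given class and level to the
`x`-axis, described as the language of a counter automaton. -/
def Accepts : Site → ℕ → List Step → Prop
  | .equator, k, [] => k = 0
  | .equator, k, .U :: P => Accepts .upperLeft k P
  | .equator, k + 1, .Dbar :: P => Accepts .upperRight k P
  | .upperLeft, k, .F :: P => Accepts .upperRight k P
  | .upperLeft, k, .Ubar :: P => Accepts .equator (k + 1) P
  | .upperRight, k, .D :: P => Accepts .equator k P
  | .upperRight, k, .Fbar :: P => Accepts .upperLeft k P
  | _, _, _ => False

theorem exists_isPath_iff_accepts (P : List Step) : ∀ {s : Site} {k : ℕ} {m h : ℤ}, s.IsAt k m h →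
    0 ≤ m → ((∃ q : ℝ × ℝ, IsPath (latticePoint m h) P q ∧ q.2 = 0) ↔ Accepts s k P) := by
  induction P with
  | nil =>
    intro s k m h hs hm
    have : (∃ q : ℝ × ℝ, IsPath (latticePoint m h) [] q ∧ q.2 = 0) ↔ h = 0 := by
      simp [IsPath, latticePoint]
    rw [this]
    cases s <;> simp only [Site.IsAt, Accepts, iff_false] at hs ⊢ <;> omega
  | cons st P ih =>
    intro s k m h hs hm
    have hh : 0 ≤ h := by cases s <;> simp only [Site.IsAt] at hs <;> omega
    have hw : 0 ≤ m + st.width := by cases st <;> simp only [Step.width] <;> omega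
    have key : (∃ q : ℝ × ℝ, IsPath (latticePoint m h) (st :: P) q ∧ q.2 = 0) ↔
        ((2 ∣ h + st.centerShift.2 ∧ 4 ∣ m + st.centerShift.1 - (h + st.centerShift.2) - 2) ∧
          0 ≤ h + st.rise) ∧
        ∃ q : ℝ × ℝ, IsPath (latticePoint (m + st.width) (h + st.rise)) P q ∧ q.2 = 0 := by
      simp only [isPath_cons_iff hm hh]
      constructor
      · rintro ⟨q, ⟨a, b, c⟩, d⟩; exact ⟨⟨a, b⟩, q, c, d⟩
      · rintro ⟨⟨a, b⟩, q, c, d⟩; exact ⟨q, ⟨a, b, c⟩, d⟩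
    rw [key]
    -- A step is rejected because of a congruence or of its final height, or else leads to the
    -- site `s'` on level `k'`.
    have rej (h1 : ¬ ((2 ∣ h + st.centerShift.2 ∧
          4 ∣ m + st.centerShift.1 - (h + st.centerShift.2) - 2) ∧ 0 ≤ h + st.rise))
        (h2 : ¬ Accepts s k (st :: P)) := iff_of_false (fun h3 : _ ∧
          ∃ q : ℝ × ℝ, IsPath (latticePoint (m + st.width) (h + st.rise)) P q ∧ q.2 = 0 =>
            h1 h3.1) h2
    have acc (s' : Site) (k' : ℕ) (h1 : (2 ∣ h + st.centerShift.2 ∧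
          4 ∣ m + st.centerShift.1 - (h + st.centerShift.2) - 2) ∧ 0 ≤ h + st.rise)
        (h2 : s'.IsAt k' (m + st.width) (h + st.rise))
        (h3 : Accepts s k (st :: P) = Accepts s' k' P) :=
      (and_iff_right h1).trans ((ih h2 hw).trans (iff_of_eq h3.symm))
    cases s
    case equator =>
      cases st
      case U =>
        refine acc .upperLeft k ?_ ?_ (by simp only [Accepts]) <;>
          simp only [Site.IsAt, Step.centerShift, Step.rise, Step.width] at * <;> omega
      case Dbar =>
        cases k with
        | zero =>
          refine rej ?_ (by simp only [Accepts, not_false_eq_true])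
          simp only [Site.IsAt, Step.centerShift, Step.rise, Step.width] at *; omega
        | succ k =>
          refine acc .upperRight k ?_ ?_ (by simp only [Accepts]) <;>
            simp only [Site.IsAt, Step.centerShift, Step.rise, Step.width] at * <;> omega
      all_goals
        refine rej ?_ (by simp only [Accepts, not_false_eq_true])
        simp only [Site.IsAt, Step.centerShift, Step.rise, Step.width] at *; omega
    case upperLeft =>
      cases st
      case F =>
        refine acc .upperRight k ?_ ?_ (by simp only [Accepts]) <;>
          simp only [Site.IsAt, Step.centerShift, Step.rise, Step.width] at * <;> omega
      case Ubar =>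
        refine acc .equator (k + 1) ?_ ?_ (by simp only [Accepts]) <;>
          simp only [Site.IsAt, Step.centerShift, Step.rise, Step.width] at * <;> omega
      all_goals
        refine rej ?_ (by simp only [Accepts, not_false_eq_true])
        simp only [Site.IsAt, Step.centerShift, Step.rise, Step.width] at *; omega
    case upperRight =>
      cases st
      case D =>
        refine acc .equator k ?_ ?_ (by simp only [Accepts]) <;>
          simp only [Site.IsAt, Step.centerShift, Step.rise, Step.width] at * <;> omega
      case Fbar =>
        refine acc .upperLeft k ?_ ?_ (by simp only [Accepts]) <;>
          simp only [Site.IsAt, Step.centerShift, Step.rise, Step.width] at * <;> omega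
      all_goals
        refine rej ?_ (by simp only [Accepts, not_false_eq_true])
        simp only [Site.IsAt, Step.centerShift, Step.rise, Step.width] at *; omega

/-! ### First-step recurrences for the counts -/

/-- The number of words of length `n` accepted from a site of a given class and level. -/
noncomputable def numAccepted (s : Site) (k n : ℕ) : ℕ :=
  {P | Accepts s k P ∧ P.length = n}.ncard

theorem numPackingPaths_eq (n : ℕ) : numPackingPaths n = numAccepted .equator 0 n := by
  have h0 : latticePoint 0 0 = (0, 0) := by simp [latticePoint]
  have : ∀ P, P ∈ packingPaths ↔ Accepts .equator 0 P := fun P => by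
    rw [← exists_isPath_iff_accepts P (s := .equator) (k := 0) (m := 0) (h := 0)
      (by simp [Site.IsAt]) le_rfl, h0]
    rfl
  simp only [numPackingPaths, numAccepted, this]

instance : Fintype Step :=
  ⟨{.U, .F, .D, .Ubar, .Fbar, .Dbar}, fun s => by cases s <;> simp⟩

theorem ncard_cons_image {A : Set (List Step)} (st : Step) : (List.cons st '' A).ncard = A.ncard :=
  Set.ncard_image_of_injective _ List.cons_injective

/-- If the words accepted from a site are those with one of two distinct first letters followed by
a word accepted from the corresponding next site, then the counts add up. -/
theorem numAccepted_succ_of_two {s s₁ s₂ : Site} {k k₁ k₂ : ℕ} {st₁ st₂ : Step} (hne : st₁ ≠ st₂)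
    (h : ∀ st P, Accepts s k (st :: P) ↔
      st = st₁ ∧ Accepts s₁ k₁ P ∨ st = st₂ ∧ Accepts s₂ k₂ P) (n : ℕ) :
    numAccepted s k (n + 1) = numAccepted s₁ k₁ n + numAccepted s₂ k₂ n := by
  have hfin : ∀ s' k', {P | Accepts s' k' P ∧ P.length = n}.Finite := fun s' k' =>
    (List.finite_length_eq Step n).subset fun P hP => hP.2
  have : {P | Accepts s k P ∧ P.length = n + 1} =
      List.cons st₁ '' {P | Accepts s₁ k₁ P ∧ P.length = n} ∪
      List.cons st₂ '' {P | Accepts s₂ k₂ P ∧ P.length = n} := by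
    ext P
    cases P with
    | nil => simp
    | cons st P =>
      simp only [Set.mem_ofPred_eq, h, List.length_cons, Set.mem_union, Set.mem_image,
        List.cons.injEq, add_left_inj]
      grind
  rw [numAccepted, this, Set.ncard_union_eq _ ((hfin _ _).image _) ((hfin _ _).image _),
    ncard_cons_image, ncard_cons_image, numAccepted, numAccepted]
  rw [Set.disjoint_left]
  rintro _ ⟨P, -, rfl⟩ ⟨Q, -, hQ⟩
  exact hne (List.cons.inj hQ).1.symm

theorem numAccepted_succ_of_one {s s₁ : Site} {k k₁ : ℕ} {st₁ : Step}
    (h : ∀ st P, Accepts s k (st :: P) ↔ st = st₁ ∧ Accepts s₁ k₁ P) (n : ℕ) :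
    numAccepted s k (n + 1) = numAccepted s₁ k₁ n := by
  have : {P | Accepts s k P ∧ P.length = n + 1} =
      List.cons st₁ '' {P | Accepts s₁ k₁ P ∧ P.length = n} := by
    ext P
    cases P with
    | nil => simp
    | cons st P =>
      simp only [Set.mem_ofPred_eq, h, List.length_cons, Set.mem_image,
        List.cons.injEq, add_left_inj]
      grind
  rw [numAccepted, this, ncard_cons_image, numAccepted]

theorem numAccepted_equator_zero_succ (n : ℕ) :
    numAccepted .equator 0 (n + 1) = numAccepted .upperLeft 0 n :=
  numAccepted_succ_of_one (st₁ := .U) (fun st P => by cases st <;> simp [Accepts]) n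

theorem numAccepted_equator_succ_succ (k n : ℕ) : numAccepted .equator (k + 1) (n + 1) =
    numAccepted .upperLeft (k + 1) n + numAccepted .upperRight k n :=
  numAccepted_succ_of_two (st₁ := .U) (st₂ := .Dbar) (by simp)
    (fun st P => by cases st <;> simp [Accepts]) n

theorem numAccepted_upperLeft_succ (k n : ℕ) : numAccepted .upperLeft k (n + 1) =
    numAccepted .upperRight k n + numAccepted .equator (k + 1) n :=
  numAccepted_succ_of_two (st₁ := .F) (st₂ := .Ubar) (by simp)
    (fun st P => by cases st <;> simp [Accepts]) n

theorem numAccepted_upperRight_succ (k n : ℕ) : numAccepted .upperRight k (n + 1) =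
    numAccepted .equator k n + numAccepted .upperLeft k n :=
  numAccepted_succ_of_two (st₁ := .D) (st₂ := .Fbar) (by simp)
    (fun st P => by cases st <;> simp [Accepts]) n

theorem numAccepted_zero_of_not {s : Site} {k : ℕ} (h : ¬ Accepts s k []) :
    numAccepted s k 0 = 0 := by
  have : {P | Accepts s k P ∧ P.length = 0} = ∅ := by
    ext P
    simp only [Set.mem_ofPred_eq, List.length_eq_zero_iff, Set.mem_empty_iff_false, iff_false]
    rintro ⟨hP, rfl⟩
    exact h hP
  rw [numAccepted, this, Set.ncard_empty]

theorem numAccepted_equator_zero_zero : numAccepted .equator 0 0 = 1 := by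
  have : {P | Accepts .equator 0 P ∧ P.length = 0} = {[]} := by
    ext P
    simp only [Set.mem_ofPred_eq, List.length_eq_zero_iff, Set.mem_singleton_iff,
      and_iff_right_iff_imp]
    rintro rfl
    simp [Accepts]
  rw [numAccepted, this, Set.ncard_singleton]

/-! ### The Catalan series at `x³ / (1 - x)` -/

open PowerSeries

/-- The power series `x³ / (1 - x)`. -/
noncomputable def catalanArg : PowerSeries ℚ := X ^ 3 * mk 1

theorem mk_one_eq : (mk 1 : PowerSeries ℚ) = 1 + X * mk 1 := by
  linear_combination mk_one_mul_one_sub_eq_one ℚ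

theorem hasSubst_catalanArg : HasSubst catalanArg :=
  HasSubst.of_constantCoeff_zero' (by simp [catalanArg])

/-- The Catalan generating function with rational coefficients. -/
noncomputable def catalanSeriesRat : PowerSeries ℚ := map (Nat.castRingHom ℚ) catalanSeries

theorem catalanSeriesRat_eq : catalanSeriesRat = 1 + X * catalanSeriesRat ^ 2 := by
  have := congrArg (map (Nat.castRingHom ℚ)) catalanSeries_sq_mul_X_add_one
  simp only [map_add, map_mul, map_pow, map_X, map_one] at this
  rw [catalanSeriesRat]
  linear_combination -this

/-- The closed form of the generating function of packing paths: the Catalan generating function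
evaluated at `x³ / (1 - x)`. -/
noncomputable def pathSeries : PowerSeries ℚ := catalanSeriesRat.subst catalanArg

theorem pathSeries_eq : pathSeries = 1 + X ^ 3 * mk 1 * pathSeries ^ 2 := by
  have h := congrArg (substAlgHom (R := ℚ) hasSubst_catalanArg) catalanSeriesRat_eq
  simp only [map_add, map_mul, map_pow, map_one, substAlgHom_X, coe_substAlgHom] at h
  exact h

theorem coeff_mk_one_pow (k m : ℕ) :
    coeff m ((mk 1 : PowerSeries ℚ) ^ k) = (Ring.choose ((m : ℤ) + k - 1) m : ℤ) := by
  cases k with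
  | zero =>
    cases m with
    | zero => simp
    | succ m =>
      have : ((m + 1 : ℕ) : ℤ) + (0 : ℕ) - 1 = (m : ℕ) := by push_cast; ring
      rw [this, Ring.choose_natCast]
      simp [coeff_one]
  | succ k =>
    have : (m : ℤ) + (k + 1 : ℕ) - 1 = ((k + m : ℕ) : ℤ) := by push_cast; ring
    rw [this, Ring.choose_natCast, mk_one_pow_eq_mk_choose_add, coeff_mk]
    simp [Nat.choose_symm_add]

theorem coeff_catalanArg_pow (k n : ℕ) : coeff n (catalanArg ^ k) =
    if 3 * k ≤ n then ((Ring.choose ((n : ℤ) - 2 * k - 1) (n - 3 * k) : ℤ) : ℚ) else 0 := by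
  rw [catalanArg, mul_pow, ← pow_mul, coeff_X_pow_mul']
  split_ifs with h
  · rw [coeff_mk_one_pow, Nat.cast_sub h]
    congr 3
    push_cast; ring
  · rfl

theorem coeff_pathSeries (n : ℕ) : coeff n pathSeries =
    ∑ k ∈ Finset.range (n / 3 + 1), 1 / ((k : ℚ) + 1) * ((2 * k).choose k : ℚ) *
      ((Ring.choose ((n : ℤ) - 2 * (k : ℤ) - 1) (n - 3 * k) : ℤ) : ℚ) := by
  rw [pathSeries, coeff_subst' hasSubst_catalanArg,
    finsum_eq_sum_of_support_subset (s := Finset.range (n / 3 + 1))]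
  · refine Finset.sum_congr rfl fun k hk => ?_
    have h3 : 3 * k ≤ n := by rw [Finset.mem_range] at hk; omega
    rw [coeff_catalanArg_pow, if_pos h3, catalanSeriesRat, coeff_map, catalanSeries_coeff,
      smul_eq_mul]
    congr 1
    have := succ_mul_catalan_eq_centralBinom k
    rw [Nat.centralBinom] at this
    rw [← this]
    have : (k : ℚ) + 1 ≠ 0 := by positivity
    simp only [eq_natCast]
    push_cast
    field_simp
  · intro k hk
    rw [Function.mem_support, coeff_catalanArg_pow] at hk
    simp only [Finset.coe_range, Set.mem_Iio]
    by_contra h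
    exact hk (by rw [if_neg (by omega), smul_zero])

/-! ### Solving the recurrences -/

/-- The factor `α` with `α S` the generating function of the words accepted from the upper left
sites on level `0`, where `S` is `pathSeries`. -/
noncomputable def upperLeftFactor : PowerSeries ℚ := X ^ 2 * mk 1 * pathSeries

/-- The factor `β` with `β S` the generating function of the words accepted from the upper right
sites on level `0`, where `S` is `pathSeries`. -/
noncomputable def upperRightFactor : PowerSeries ℚ := X * (1 + upperLeftFactor)

/-- The factor by which the generating functions of accepted words change from one level to
the next. -/
noncomputable def levelFactor : PowerSeries ℚ := X * upperRightFactor * pathSeries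

theorem pathSeries_eq_upperLeftFactor : pathSeries = 1 + X * (upperLeftFactor * pathSeries) := by
  rw [upperLeftFactor]; linear_combination pathSeries_eq

theorem upperLeftFactor_eq : upperLeftFactor = X * (upperRightFactor + levelFactor) := by
  have hS := pathSeries_eq
  have hJ := mk_one_eq
  rw [levelFactor, upperRightFactor, upperLeftFactor]
  set S := pathSeries
  set J : PowerSeries ℚ := mk 1
  linear_combination X ^ 2 * (1 + X) * S * hJ + X ^ 2 * hS

/-- The predicted generating functions of the words accepted from the sites. -/
noncomputable def predictedSeries : Site → ℕ → PowerSeries ℚ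
  | .equator, k => pathSeries * levelFactor ^ k
  | .upperLeft, k => upperLeftFactor * pathSeries * levelFactor ^ k
  | .upperRight, k => upperRightFactor * pathSeries * levelFactor ^ k

theorem predictedSeries_equator_zero :
    predictedSeries .equator 0 = 1 + X * predictedSeries .upperLeft 0 := by
  simp only [predictedSeries]
  linear_combination pathSeries_eq_upperLeftFactor

theorem predictedSeries_equator_succ (k : ℕ) : predictedSeries .equator (k + 1) =
    X * (predictedSeries .upperLeft (k + 1) + predictedSeries .upperRight k) := by
  have h : levelFactor = X * (upperLeftFactor * levelFactor + upperRightFactor) := by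
    rw [levelFactor]; linear_combination X * upperRightFactor * pathSeries_eq_upperLeftFactor
  simp only [predictedSeries]
  linear_combination pathSeries * levelFactor ^ k * h

theorem predictedSeries_upperLeft (k : ℕ) : predictedSeries .upperLeft k =
    X * (predictedSeries .upperRight k + predictedSeries .equator (k + 1)) := by
  simp only [predictedSeries]
  linear_combination pathSeries * levelFactor ^ k * upperLeftFactor_eq

theorem predictedSeries_upperRight (k : ℕ) : predictedSeries .upperRight k =
    X * (predictedSeries .equator k + predictedSeries .upperLeft k) := by
  simp only [predictedSeries, upperRightFactor]
  ring

/-- The first-step recurrences determine all coefficients, and both families satisfy them. -/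
theorem coeff_predictedSeries (n : ℕ) :
    ∀ s k, coeff n (predictedSeries s k) = (numAccepted s k n : ℚ) := by
  induction n with
  | zero =>
    intro s k
    match s, k with
    | .equator, 0 => simp [predictedSeries_equator_zero, numAccepted_equator_zero_zero]
    | .equator, k + 1 =>
      simp [predictedSeries_equator_succ, numAccepted_zero_of_not, Accepts]
    | .upperLeft, k =>
      rw [numAccepted_zero_of_not (by cases k <;> simp [Accepts])]
      simp [predictedSeries_upperLeft]
    | .upperRight, k =>
      rw [numAccepted_zero_of_not (by cases k <;> simp [Accepts])]
      simp [predictedSeries_upperRight]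
  | succ n ih =>
    intro s k
    match s, k with
    | .equator, 0 =>
      simp [predictedSeries_equator_zero, numAccepted_equator_zero_succ, coeff_succ_X_mul, ih,
        coeff_one]
    | .equator, k + 1 =>
      rw [predictedSeries_equator_succ, numAccepted_equator_succ_succ, coeff_succ_X_mul, map_add,
        ih, ih, Nat.cast_add]
    | .upperLeft, k =>
      rw [predictedSeries_upperLeft, numAccepted_upperLeft_succ, coeff_succ_X_mul, map_add, ih, ih,
        Nat.cast_add]
    | .upperRight, k =>
      rw [predictedSeries_upperRight, numAccepted_upperRight_succ, coeff_succ_X_mul, map_add, ih,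
        ih, Nat.cast_add]

theorem packingSeries_eq : packingSeries = pathSeries := by
  ext n
  have := coeff_predictedSeries n .equator 0
  rw [predictedSeries, pow_zero, mul_one] at this
  rw [packingSeries, coeff_mk, numPackingPaths_eq, this]

/-- The square root of `(1 - x)(1 - 2x)(1 + x + 2x²)` with constant term `1`. -/
noncomputable def discriminantRoot : PowerSeries ℚ := 1 - X - 2 * X ^ 3 * pathSeries

theorem constantCoeff_discriminantRoot : constantCoeff discriminantRoot = 1 := by
  simp [discriminantRoot]

theorem discriminantRoot_sq :
    discriminantRoot ^ 2 = (1 - X) * (1 - 2 * X) * (1 + X + 2 * X ^ 2) := by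
  have hS := pathSeries_eq
  have hJ := mk_one_eq
  rw [discriminantRoot]
  set S := pathSeries
  set J : PowerSeries ℚ := mk 1
  linear_combination (-4 * X ^ 3 * (1 - X)) * hS - 4 * X ^ 6 * S ^ 2 * hJ

theorem coeff_discriminantRoot (n : ℕ) :
    coeff (n + 3) discriminantRoot = -2 * (numPackingPaths n : ℚ) := by
  have h1 : discriminantRoot = 1 - X - C 2 * (X ^ 3 * pathSeries) := by
    rw [discriminantRoot, map_ofNat]; ring
  rw [h1, ← packingSeries_eq, map_sub, map_sub, coeff_C_mul, coeff_X_pow_mul, coeff_one, coeff_X,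
    packingSeries, coeff_mk]
  simp

/-! ### Coefficients of the square root of `1 - x` -/

open Filter Topology

/-- If `b_k = (2k choose k)`, then `b_k √k / 4 ^ k` tends to `1 / √π`, by Stirling's formula. -/
theorem tendsto_centralBinom :
    Tendsto (fun k : ℕ => (Nat.centralBinom k : ℝ) * Real.sqrt k / 4 ^ k) atTop
      (𝓝 (1 / Real.sqrt Real.pi)) := by
  have hpi : 0 < Real.sqrt Real.pi := Real.sqrt_pos.2 Real.pi_pos
  have h1 := Stirling.tendsto_stirlingSeq_sqrt_pi
  have h2 : Tendsto (fun k : ℕ => 2 * k) atTop atTop :=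
    tendsto_id.const_mul_atTop' (by norm_num)
  have h3 := (h1.comp h2).div (h1.pow 2) (by positivity)
  have e : Real.sqrt Real.pi / Real.sqrt Real.pi ^ 2 = 1 / Real.sqrt Real.pi := by field_simp
  rw [e] at h3
  refine h3.congr' ?_
  filter_upwards [eventually_gt_atTop 0] with k hk
  have hk' : (0 : ℝ) < k := by exact_mod_cast hk
  have hs : 0 < Real.sqrt k := Real.sqrt_pos.2 hk'
  have hcb : ((2 * k).factorial : ℝ) = Nat.centralBinom k * (k.factorial : ℝ) ^ 2 := by
    have := Nat.choose_mul_factorial_mul_factorial (n := 2 * k) (k := k) (by omega)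
    rw [show 2 * k - k = k by omega] at this
    rw [Nat.centralBinom, ← this]; push_cast; ring
  have s1 : Real.sqrt (2 * ((2 * k : ℕ) : ℝ)) = 2 * Real.sqrt k := by
    rw [show (2 * ((2 * k : ℕ) : ℝ)) = 2 ^ 2 * k by push_cast; ring,
      Real.sqrt_mul (by norm_num), Real.sqrt_sq (by norm_num)]
  have s2 : Real.sqrt (2 * (k : ℝ)) ^ 2 = 2 * Real.sqrt k ^ 2 := by
    rw [Real.sq_sqrt (by positivity), Real.sq_sqrt (by positivity)]
  have hf : (0 : ℝ) < k.factorial := by exact_mod_cast k.factorial_pos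
  have he : 0 < Real.exp 1 := Real.exp_pos 1
  simp only [Pi.div_apply, Function.comp, Stirling.stirlingSeq, div_pow, mul_pow, hcb, s1, s2]
  rw [show ((2 * k : ℕ) : ℝ) = 2 * k by push_cast; ring, mul_pow, pow_mul 2 2 k]
  generalize Real.exp 1 = E at he
  norm_num
  field_simp
  rw [Real.sq_sqrt hk'.le]
  ring

/-- The power series `√(1 - x) = 1 - (x / 2) C(x / 4)`, with `C` the Catalan generating
function. -/
noncomputable def sqrtOneSub : PowerSeries ℂ :=
  1 - C (1 / 2) * (X * rescale (1 / 4) (PowerSeries.map (Nat.castRingHom ℂ) catalanSeries))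

theorem sqrtOneSub_sq : sqrtOneSub ^ 2 = 1 - X := by
  have h := congrArg (rescale (1 / 4 : ℂ))
    (congrArg (PowerSeries.map (Nat.castRingHom ℂ)) catalanSeries_sq_mul_X_add_one)
  simp only [map_add, map_mul, map_pow, map_X, map_one, rescale_X] at h
  have e : (C (1 / 2 : ℂ)) ^ 2 = C (1 / 4) := by rw [← map_pow]; norm_num
  have e' : C (1 / 2 : ℂ) * 2 = 1 := by
    rw [← map_ofNat (C (R := ℂ)), ← map_mul]; norm_num
  rw [sqrtOneSub]
  set c := rescale (1 / 4 : ℂ) (PowerSeries.map (Nat.castRingHom ℂ) catalanSeries)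
  linear_combination X ^ 2 * c ^ 2 * e - X * c * e' + X * h

theorem coeff_zero_sqrtOneSub : coeff 0 sqrtOneSub = 1 := by simp [sqrtOneSub]

theorem coeff_succ_sqrtOneSub (k : ℕ) :
    coeff (k + 1) sqrtOneSub = ((-(1 / 2) * (catalan k / 4 ^ k) : ℝ) : ℂ) := by
  simp only [sqrtOneSub, map_sub, coeff_one, coeff_C_mul, coeff_succ_X_mul, coeff_rescale,
    coeff_map, catalanSeries_coeff]
  simp
  field_simp

theorem catalan_eq_div (k : ℕ) : (catalan k : ℝ) = Nat.centralBinom k / (k + 1) := by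
  rw [← succ_mul_catalan_eq_centralBinom]
  push_cast
  field_simp

theorem catalan_le_four_pow (k : ℕ) : (catalan k : ℝ) ≤ 4 ^ k := by
  rw [catalan_eq_div]
  have h1 : (Nat.centralBinom k : ℝ) ≤ 4 ^ k := by
    have := Nat.choose_le_two_pow (2 * k) k
    rw [pow_mul] at this
    exact_mod_cast this
  exact (div_le_self (by positivity) (by linarith [(Nat.cast_nonneg k : (0 : ℝ) ≤ k)])).trans h1

theorem norm_coeff_sqrtOneSub_le (n : ℕ) : ‖coeff n sqrtOneSub‖ ≤ 1 := by
  cases n with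
  | zero => simp [coeff_zero_sqrtOneSub]
  | succ k =>
    rw [coeff_succ_sqrtOneSub, Complex.norm_real, norm_mul]
    have h1 : ‖(catalan k / 4 ^ k : ℝ)‖ ≤ 1 := by
      rw [Real.norm_of_nonneg (by positivity)]
      exact div_le_one_of_le₀ (catalan_le_four_pow k) (by positivity)
    have h2 : ‖(-(1 / 2) : ℝ)‖ = 1 / 2 := by norm_num
    rw [h2]; linarith

/-! ### Convolution with a sequence of faster decay -/

/-- The normalizing weight `(n + 1) ^ (3 / 2)`. -/
noncomputable def weight (n : ℕ) : ℝ := ((n : ℝ) + 1) ^ (3 / 2 : ℝ)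

theorem weight_pos (n : ℕ) : 0 < weight n := by unfold weight; positivity

theorem weight_eq (n : ℕ) : weight n = (n + 1) * Real.sqrt (n + 1) := by
  rw [weight, Real.sqrt_eq_rpow, ← Real.rpow_one_add' (by positivity) (by norm_num)]
  norm_num

theorem weight_le_sq (n : ℕ) : weight n ≤ ((n : ℝ) + 1) ^ 2 := by
  rw [weight, ← Real.rpow_natCast]
  exact Real.rpow_le_rpow_of_exponent_le (by linarith [(Nat.cast_nonneg n : (0 : ℝ) ≤ n)])
    (by norm_num)

theorem weight_add_le (i j : ℕ) : weight (i + j) ≤ weight i * weight j := by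
  unfold weight
  rw [← Real.mul_rpow (by positivity) (by positivity)]
  refine Real.rpow_le_rpow (by positivity) ?_ (by norm_num)
  push_cast
  nlinarith [mul_nonneg (Nat.cast_nonneg i : (0 : ℝ) ≤ i) (Nat.cast_nonneg j : (0 : ℝ) ≤ j)]

theorem tendsto_natCast_add_div_natCast_add (a b : ℝ) :
    Tendsto (fun n : ℕ => ((n : ℝ) + a) / (n + b)) atTop (𝓝 1) := by
  have h : Tendsto (fun n : ℕ => 1 + (a - b) / ((n : ℝ) + b)) atTop (𝓝 (1 + 0)) :=
    tendsto_const_nhds.add (tendsto_const_nhds.div_atTop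
      (tendsto_atTop_add_const_right _ _ tendsto_natCast_atTop_atTop))
  rw [add_zero] at h
  refine h.congr' ?_
  filter_upwards [(tendsto_atTop_add_const_right _ b
    tendsto_natCast_atTop_atTop).eventually_gt_atTop (0 : ℝ)] with n hn
  field_simp
  ring

theorem tendsto_weight_add_div_weight (k : ℕ) :
    Tendsto (fun n => weight (n + k) / weight n) atTop (𝓝 1) := by
  have h := (tendsto_natCast_add_div_natCast_add (k + 1) 1).rpow_const (p := 3 / 2)
    (Or.inl one_ne_zero)
  rw [Real.one_rpow] at h
  refine h.congr fun n => ?_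
  rw [weight, weight, Real.div_rpow (by positivity) (by positivity)]
  push_cast
  ring_nf

theorem tendsto_weight_mul_coeff_sqrtOneSub :
    Tendsto (fun n => (weight n : ℂ) * coeff n sqrtOneSub) atTop
      (𝓝 ((-(1 / (2 * Real.sqrt Real.pi)) : ℝ) : ℂ)) := by
  rw [← tendsto_add_atTop_iff_nat 1]
  have h1 := (tendsto_centralBinom.mul (tendsto_natCast_add_div_natCast_add 2 1)).mul
    ((tendsto_natCast_add_div_natCast_add 2 0).sqrt)
  have h2 := (h1.const_mul (-(1 / 2)))
  have e : -(1 / 2) * (1 / Real.sqrt Real.pi * 1 * Real.sqrt 1) =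
      -(1 / (2 * Real.sqrt Real.pi)) := by
    rw [Real.sqrt_one]; ring
  rw [e] at h2
  refine ((Complex.continuous_ofReal.tendsto _).comp h2).congr' ?_
  filter_upwards [eventually_gt_atTop 0] with k hk
  have hk' : (0 : ℝ) < k := by exact_mod_cast hk
  have hs : 0 < Real.sqrt k := Real.sqrt_pos.2 hk'
  rw [coeff_succ_sqrtOneSub, Function.comp, ← Complex.ofReal_mul, weight_eq, catalan_eq_div,
    add_zero, Real.sqrt_div (by positivity)]
  refine congrArg Complex.ofReal ?_
  push_cast
  rw [show (k : ℝ) + 1 + 1 = k + 2 by ring]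
  field_simp

/-- If `(n + 1) ^ (3 / 2) t_n` converges and `h` is summable against the same weight, then
convolving `t` with `h` multiplies the limit by the sum of `h`, by dominated convergence. -/
theorem tendsto_weight_mul_convolution {t h : ℕ → ℂ} {c : ℂ}
    (ht : Tendsto (fun n => (weight n : ℂ) * t n) atTop (𝓝 c))
    (hh : Summable fun k => ‖h k‖ * weight k) :
    Tendsto (fun n => (weight n : ℂ) * ∑ k ∈ Finset.range (n + 1), h k * t (n - k)) atTop
      (𝓝 (c * ∑' k, h k)) := by
  obtain ⟨M, hM⟩ := (Metric.isBounded_range_of_tendsto _ ht).exists_norm_le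
  have hM' : ∀ n, weight n * ‖t n‖ ≤ M := fun n => by
    have := hM _ ⟨n, rfl⟩
    rwa [norm_mul, Complex.norm_real, Real.norm_of_nonneg (weight_pos n).le] at this
  let f : ℕ → ℕ → ℂ := fun n k => if k ≤ n then (weight n : ℂ) * (h k * t (n - k)) else 0
  have hf : ∀ n, ∑' k, f n k =
      (weight n : ℂ) * ∑ k ∈ Finset.range (n + 1), h k * t (n - k) := fun n => by
    rw [tsum_eq_sum (s := Finset.range (n + 1)), Finset.mul_sum]
    · refine Finset.sum_congr rfl fun k hk => if_pos ?_
      rw [Finset.mem_range] at hk; omega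
    · intro k hk
      refine if_neg ?_
      rw [Finset.mem_range] at hk; omega
  rw [← tsum_mul_left]
  simp only [← hf]
  refine tendsto_tsum_of_dominated_convergence (hh.mul_left M) (fun k => ?_)
    (Eventually.of_forall fun n k => ?_)
  · rw [← tendsto_add_atTop_iff_nat k]
    have h1 := ((Complex.continuous_ofReal.tendsto _).comp
      (tendsto_weight_add_div_weight k)).mul (ht.mul_const (h k))
    rw [Complex.ofReal_one, one_mul] at h1
    refine h1.congr fun n => ?_
    have := Complex.ofReal_ne_zero.2 (weight_pos n).ne'
    simp only [f, Function.comp, if_pos (Nat.le_add_left k n), Nat.add_sub_cancel]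
    push_cast
    field_simp
  · by_cases hk : k ≤ n
    · obtain ⟨i, rfl⟩ := Nat.exists_eq_add_of_le' hk
      simp only [f, if_pos hk, Nat.add_sub_cancel, norm_mul, Complex.norm_real]
      rw [Real.norm_of_nonneg (weight_pos _).le]
      calc weight (i + k) * (‖h k‖ * ‖t i‖)
          ≤ (weight i * weight k) * (‖h k‖ * ‖t i‖) :=
            mul_le_mul_of_nonneg_right (weight_add_le i k) (by positivity)
        _ = (weight i * ‖t i‖) * (‖h k‖ * weight k) := by ring
        _ ≤ M * (‖h k‖ * weight k) :=
            mul_le_mul_of_nonneg_right (hM' i) (mul_nonneg (norm_nonneg _) (weight_pos k).le)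
    · simp only [f, if_neg hk, norm_zero]
      exact mul_nonneg ((mul_nonneg (weight_pos 0).le (norm_nonneg _)).trans (hM' 0))
        (mul_nonneg (norm_nonneg _) (weight_pos k).le)

/-! ### The discriminant root near its dominant singularity -/

/-- The reciprocals of the roots of `1 + x + 2x²` are this number and its conjugate. -/
noncomputable def quadRoot : ℂ := ⟨-(1 / 2), Real.sqrt 7 / 2⟩

theorem quadRoot_add_conj : quadRoot + starRingEnd ℂ quadRoot = -1 := by
  rw [Complex.add_conj]; simp [quadRoot]

theorem quadRoot_mul_conj : quadRoot * starRingEnd ℂ quadRoot = 2 := by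
  rw [Complex.mul_conj, Complex.normSq_apply]
  have := Real.mul_self_sqrt (show (0 : ℝ) ≤ 7 by norm_num)
  rw [show (quadRoot.re * quadRoot.re + quadRoot.im * quadRoot.im : ℝ) = 2 by
    simp only [quadRoot]; linarith]
  norm_num

theorem norm_quadRoot : ‖quadRoot‖ = Real.sqrt 2 := by
  have h := congrArg norm quadRoot_mul_conj
  rw [norm_mul, RCLike.norm_conj] at h
  rw [eq_comm, Real.sqrt_eq_iff_mul_self_eq (by norm_num) (norm_nonneg _), h]
  norm_num

/-- The factor `√((1 - x)(1 + x + 2x²))` of the discriminant root that is analytic near the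
dominant singularity `x = 1 / 2`. -/
noncomputable def regularPart : PowerSeries ℂ :=
  sqrtOneSub * rescale quadRoot sqrtOneSub * rescale (starRingEnd ℂ quadRoot) sqrtOneSub

theorem rescale_sqrtOneSub_sq (a : ℂ) : rescale a sqrtOneSub ^ 2 = 1 - C a * X := by
  rw [← map_pow, sqrtOneSub_sq, map_sub, map_one, rescale_X]

theorem regularPart_sq : regularPart ^ 2 = (1 - X) * (1 + X + 2 * X ^ 2) := by
  have h1 := congrArg (C (R := ℂ)) quadRoot_add_conj
  have h2 := congrArg (C (R := ℂ)) quadRoot_mul_conj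
  simp only [map_add, map_neg, map_one, map_mul, map_ofNat] at h1 h2
  rw [regularPart, mul_pow, mul_pow, rescale_sqrtOneSub_sq, rescale_sqrtOneSub_sq, sqrtOneSub_sq]
  linear_combination (1 - X) * (-X * h1 + X ^ 2 * h2)

theorem norm_coeff_mul_le {f g : PowerSeries ℂ} {s : ℝ} {d : ℕ} (hs : 0 ≤ s)
    (hf : ∀ n, ‖coeff n f‖ ≤ ((n : ℝ) + 1) ^ d * s ^ n) (hg : ∀ n, ‖coeff n g‖ ≤ s ^ n) (n : ℕ) :
    ‖coeff n (f * g)‖ ≤ ((n : ℝ) + 1) ^ (d + 1) * s ^ n := by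
  rw [coeff_mul]
  have hle : ∀ p ∈ Finset.HasAntidiagonal.antidiagonal n,
      ‖coeff p.1 f * coeff p.2 g‖ ≤ ((n : ℝ) + 1) ^ d * s ^ n := by
    intro p hp
    rw [Finset.HasAntidiagonal.mem_antidiagonal] at hp
    have hp1 : (p.1 : ℝ) ≤ n := by exact_mod_cast hp ▸ Nat.le_add_right p.1 p.2
    calc ‖coeff p.1 f * coeff p.2 g‖ ≤ (((p.1 : ℝ) + 1) ^ d * s ^ p.1) * s ^ p.2 := by
          rw [norm_mul]
          exact mul_le_mul (hf _) (hg _) (norm_nonneg _) (by positivity)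
      _ = ((p.1 : ℝ) + 1) ^ d * s ^ n := by rw [mul_assoc, ← pow_add, hp]
      _ ≤ ((n : ℝ) + 1) ^ d * s ^ n := by gcongr
  refine (norm_sum_le_of_le _ hle).trans ?_
  rw [Finset.sum_const, Finset.Nat.card_antidiagonal, nsmul_eq_mul, pow_succ]
  push_cast
  exact le_of_eq (by ring)

theorem norm_coeff_rescale_sqrtOneSub_le (a : ℂ) (n : ℕ) :
    ‖coeff n (rescale a sqrtOneSub)‖ ≤ ‖a‖ ^ n := by
  rw [coeff_rescale, norm_mul, norm_pow]
  exact mul_le_of_le_one_right (by positivity) (norm_coeff_sqrtOneSub_le n)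

theorem norm_coeff_regularPart_le (n : ℕ) :
    ‖coeff n regularPart‖ ≤ ((n : ℝ) + 1) ^ 2 * Real.sqrt 2 ^ n := by
  have h1 : (1 : ℝ) ≤ Real.sqrt 2 := Real.one_le_sqrt.mpr (by norm_num)
  refine norm_coeff_mul_le (by positivity) (norm_coeff_mul_le (d := 0) (by positivity)
    (fun k => ?_) fun k => ?_) (fun k => ?_) n
  · rw [pow_zero, one_mul]
    exact (norm_coeff_sqrtOneSub_le k).trans (one_le_pow₀ h1)
  · simpa only [norm_quadRoot] using norm_coeff_rescale_sqrtOneSub_le quadRoot k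
  · simpa only [norm_quadRoot, RCLike.norm_conj] using
      norm_coeff_rescale_sqrtOneSub_le (starRingEnd ℂ quadRoot) k

theorem summable_norm_coeff_regularPart_mul_weight :
    Summable fun k => ‖coeff k regularPart / 2 ^ k‖ * weight k := by
  have hr : ‖Real.sqrt 2 / 2‖ < 1 := by
    rw [Real.norm_of_nonneg (by positivity), div_lt_one (by norm_num)]
    exact (Real.sqrt_lt' (by norm_num)).2 (by norm_num)
  have hsum : Summable fun k : ℕ => ((k : ℝ) + 1) ^ 4 * (Real.sqrt 2 / 2) ^ k := by
    have h : Summable fun k : ℕ => ((k + 1 : ℕ) : ℝ) ^ 4 * (Real.sqrt 2 / 2) ^ (k + 1) :=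
      (summable_nat_add_iff (f := fun k : ℕ => (k : ℝ) ^ 4 * (Real.sqrt 2 / 2) ^ k) 1).2
        (summable_pow_mul_geometric_of_norm_lt_one 4 hr)
    refine (h.mul_right (Real.sqrt 2 / 2)⁻¹).congr fun k => ?_
    have : Real.sqrt 2 / 2 ≠ 0 := by positivity
    push_cast
    rw [pow_succ (Real.sqrt 2 / 2), ← mul_assoc, mul_inv_cancel_right₀ this]
  refine hsum.of_nonneg_of_le
    (fun k => mul_nonneg (norm_nonneg _) (weight_pos k).le) fun k => ?_
  rw [norm_div, norm_pow, Complex.norm_two]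
  calc ‖coeff k regularPart‖ / 2 ^ k * weight k
      ≤ (((k : ℝ) + 1) ^ 2 * Real.sqrt 2 ^ k) / 2 ^ k * ((k : ℝ) + 1) ^ 2 := by
        refine mul_le_mul ?_ (weight_le_sq k) (weight_pos k).le (by positivity)
        gcongr
        exact norm_coeff_regularPart_le k
    _ = ((k : ℝ) + 1) ^ 4 * (Real.sqrt 2 / 2) ^ k := by rw [div_pow]; ring

/-- At `x = 1 / 2`, the polynomial `(1 - x)(1 + x + 2x²)` has the value `1`. -/
theorem tsum_regularPart_sq : (∑' k, coeff k regularPart / 2 ^ k) ^ 2 = 1 := by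
  have hs : Summable fun k => ‖coeff k regularPart / 2 ^ k‖ := by
    refine summable_norm_coeff_regularPart_mul_weight.of_nonneg_of_le
      (fun k => norm_nonneg _) fun k => ?_
    refine le_mul_of_one_le_right (norm_nonneg _) (Real.one_le_rpow ?_ (by norm_num))
    linarith [(Nat.cast_nonneg k : (0 : ℝ) ≤ k)]
  rw [sq, tsum_mul_tsum_eq_tsum_sum_antidiagonal_of_summable_norm hs hs]
  have h1 : ∀ n, ∑ p ∈ Finset.HasAntidiagonal.antidiagonal n,
      coeff p.1 regularPart / 2 ^ p.1 * (coeff p.2 regularPart / 2 ^ p.2) =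
      coeff n (1 + X ^ 2 - C (2 : ℂ) * X ^ 3) / 2 ^ n := fun n => by
    have e : (1 + X ^ 2 - C (2 : ℂ) * X ^ 3 : PowerSeries ℂ) = regularPart * regularPart := by
      rw [← sq, regularPart_sq, map_ofNat]; ring
    rw [e, coeff_mul, Finset.sum_div]
    refine Finset.sum_congr rfl fun p hp => ?_
    rw [← Finset.HasAntidiagonal.mem_antidiagonal.1 hp, pow_add, div_mul_div_comm]
  simp only [h1]
  rw [tsum_eq_sum (s := Finset.range 4)]
  · simp [Finset.sum_range_succ, coeff_one, coeff_X_pow]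
    norm_num
  · intro n hn
    rw [Finset.mem_range] at hn
    simp [coeff_one, coeff_X_pow, show n ≠ 0 by omega, show n ≠ 2 by omega,
      show n ≠ 3 by omega]

theorem map_discriminantRoot : PowerSeries.map (algebraMap ℚ ℂ) discriminantRoot =
    regularPart * rescale 2 sqrtOneSub := by
  have hsq : (PowerSeries.map (algebraMap ℚ ℂ) discriminantRoot) ^ 2 =
      (regularPart * rescale 2 sqrtOneSub) ^ 2 := by
    rw [← map_pow, discriminantRoot_sq, mul_pow, regularPart_sq, rescale_sqrtOneSub_sq]
    simp only [map_add, map_sub, map_mul, map_pow, map_one, map_X, map_ofNat]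
    ring
  rcases sq_eq_sq_iff_eq_or_eq_neg.1 hsq with h | h
  · exact h
  · exfalso
    have h0 : constantCoeff sqrtOneSub = 1 := by
      rw [← coeff_zero_eq_constantCoeff_apply, coeff_zero_sqrtOneSub]
    have h1 := congrArg (coeff 0) h
    rw [coeff_map] at h1
    simp only [coeff_zero_eq_constantCoeff, map_neg, map_mul, regularPart] at h1
    simp only [← coeff_zero_eq_constantCoeff_apply, coeff_rescale] at h1
    simp only [coeff_zero_eq_constantCoeff_apply, h0, constantCoeff_discriminantRoot] at h1
    norm_num at h1

theorem tendsto_weight_mul_coeff_discriminantRoot :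
    Tendsto (fun n => (weight n : ℂ) * (((coeff n discriminantRoot : ℚ) : ℂ) / 2 ^ n)) atTop
      (𝓝 (((-(1 / (2 * Real.sqrt Real.pi)) : ℝ) : ℂ) *
        ∑' k, coeff k regularPart / 2 ^ k)) := by
  refine (tendsto_weight_mul_convolution tendsto_weight_mul_coeff_sqrtOneSub
    summable_norm_coeff_regularPart_mul_weight).congr fun n => ?_
  have h := congrArg (coeff n) map_discriminantRoot
  rw [coeff_map, eq_ratCast, coeff_mul, Finset.Nat.sum_antidiagonal_eq_sum_range_succ_mk] at h
  rw [h, Finset.sum_div]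
  congr 1
  refine Finset.sum_congr rfl fun k hk => ?_
  have hk' : k ≤ n := by rw [Finset.mem_range] at hk; omega
  rw [coeff_rescale, ← Nat.add_sub_cancel' hk', pow_add, Nat.add_sub_cancel_left]
  field_simp

theorem tendsto_numPackingPaths :
    Tendsto (fun n : ℕ => weight (n + 3) * (numPackingPaths n / 2 ^ n)) atTop
      (𝓝 (2 / Real.sqrt Real.pi)) := by
  set G : ℂ := ∑' k, coeff k regularPart / 2 ^ k with hG
  have hpi : 0 < Real.sqrt Real.pi := Real.sqrt_pos.2 Real.pi_pos
  have h1 := ((tendsto_add_atTop_iff_nat 3).2 tendsto_weight_mul_coeff_discriminantRoot).const_mul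
    (-4 : ℂ)
  rw [← hG] at h1
  have h2 : Tendsto (fun n : ℕ => ((weight (n + 3) * (numPackingPaths n / 2 ^ n) : ℝ) : ℂ)) atTop
      (𝓝 (((2 / Real.sqrt Real.pi : ℝ) : ℂ) * G)) := by
    convert h1 using 2 with n
    · rw [coeff_discriminantRoot]
      push_cast
      rw [pow_add]
      field_simp
      norm_num
    · push_cast
      field_simp
      ring
  have hre := (Complex.continuous_re.tendsto _).comp h2
  rw [Complex.re_ofReal_mul] at hre
  have hnonneg : 0 ≤ 2 / Real.sqrt Real.pi * G.re :=
    ge_of_tendsto' hre fun n => by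
      simp only [Function.comp, Complex.ofReal_re]
      exact mul_nonneg (weight_pos _).le (by positivity)
  -- The counts are nonnegative, which selects the value `1` among the two square roots of `1`.
  have hG1 : G = 1 := by
    refine (sq_eq_one_iff.1 tsum_regularPart_sq).resolve_right fun h => ?_
    rw [← hG] at h
    rw [h, Complex.neg_re, Complex.one_re] at hnonneg
    have : 0 < 2 / Real.sqrt Real.pi := by positivity
    linarith
  rw [hG1, Complex.one_re, mul_one] at hre
  exact hre

/-- Replacing the weight `(n + 4) ^ (3 / 2)` by `n ^ (3 / 2)`. -/
theorem isEquivalent_numPackingPaths :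
    Asymptotics.IsEquivalent atTop (fun n : ℕ => (numPackingPaths n : ℝ))
      (fun n : ℕ => (2 : ℝ) ^ (n + 1) / (Real.sqrt Real.pi * (n : ℝ) ^ (3 / 2 : ℝ))) := by
  have hpi : 0 < Real.sqrt Real.pi := Real.sqrt_pos.2 Real.pi_pos
  have hpos : ∀ᶠ n : ℕ in atTop, (0 : ℝ) < (n : ℝ) ^ (3 / 2 : ℝ) := by
    filter_upwards [eventually_gt_atTop 0] with n hn
    exact Real.rpow_pos_of_pos (by exact_mod_cast hn) _
  rw [Asymptotics.isEquivalent_iff_tendsto_one (hpos.mono fun n hn => by positivity)]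
  have h1 := ((tendsto_natCast_add_div_natCast_add 0 4).rpow_const (p := 3 / 2)
    (Or.inl one_ne_zero)).mul (tendsto_numPackingPaths.mul_const (Real.sqrt Real.pi / 2))
  rw [Real.one_rpow, one_mul, div_mul_div_comm, mul_comm 2, div_self (by positivity)] at h1
  refine h1.congr' ?_
  filter_upwards [hpos] with n hn
  have hw := weight_pos (n + 3)
  rw [add_zero, Real.div_rpow (by positivity) (by positivity),
    show ((n : ℝ) + 4) ^ (3 / 2 : ℝ) = weight (n + 3) by rw [weight]; push_cast; ring_nf]
  simp only [Pi.div_apply]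
  rw [pow_succ]
  field_simp

end HexPacking

theorem mainTheorem8 :
    (∃ R : PowerSeries ℚ,
      PowerSeries.constantCoeff R = 1 ∧
      R ^ 2 = (1 - PowerSeries.X) * (1 - 2 * PowerSeries.X) *
        (1 + PowerSeries.X + 2 * PowerSeries.X ^ 2) ∧
      2 * PowerSeries.X ^ 3 * HexPacking.packingSeries = 1 - PowerSeries.X - R) ∧
    PowerSeries.coeff 0 HexPacking.packingSeries = 1 ∧
    (∀ n : ℕ, PowerSeries.coeff n HexPacking.packingSeries =
      ∑ k ∈ Finset.range (n / 3 + 1),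
        1 / ((k : ℚ) + 1) * ((2 * k).choose k : ℚ) *
          ((Ring.choose ((n : ℤ) - 2 * (k : ℤ) - 1) (n - 3 * k) : ℤ) : ℚ)) ∧
    Asymptotics.IsEquivalent Filter.atTop
      (fun n : ℕ => (HexPacking.numPackingPaths n : ℝ))
      (fun n : ℕ => (2 : ℝ) ^ (n + 1) / (Real.sqrt Real.pi * (n : ℝ) ^ (3 / 2 : ℝ))) := by
  refine ⟨⟨HexPacking.discriminantRoot, HexPacking.constantCoeff_discriminantRoot,
    HexPacking.discriminantRoot_sq, ?_⟩, ?_, fun n => ?_, HexPacking.isEquivalent_numPackingPaths⟩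
  · rw [HexPacking.packingSeries_eq, HexPacking.discriminantRoot]; ring
  · rw [HexPacking.packingSeries, PowerSeries.coeff_mk, HexPacking.numPackingPaths_eq,
      HexPacking.numAccepted_equator_zero_zero, Nat.cast_one]
  · rw [HexPacking.packingSeries_eq, HexPacking.coeff_pathSeries]
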